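/- Let $n\ge 1$, let $A,F,Q\in\mathbb R^{n\times n}$ with $F,Q$ symmetric positive definite, and let $F=LL^\top$ be the Cholesky factorization of $F$ ($L$ lower triangular with positive diagonal). Write $\mathcal R(X):=A^\top X+XA-XFX+Q$, let $\mathcal W(M):=\{x^HMx:\ x\in\mathbb C^n,\ \|x\|_2=1\}$ be the numerical range, let $\mathbb C^-:=\{z:\Re z<0\}$, and call a real matrix *stable* if all its eigenvalues lie in $\mathbb C^-$. Denote by $\lambda_{\min},\lambda_{\max}$ the extreme eigenvalues of a symmetric matrix and by $\kappa(F)=\|F\|_2\|F^{-1}\|_2$ the condition number, and let $\mathrm{vec}$ be the column-stacking map. Consider the inexact Newton–Kleinman (TINK) iteration without truncation, started at $\widetilde X_0$. In outer iteration $k$ put $$\widetilde A_{cl,k}:=A-F\widetilde X_k,\qquad \widetilde{\mathcal A}_k:=I\otimes \widetilde A_{cl,k}^\top+\widetilde A_{cl,k}^\top\otimes I,\qquad b_k:=-\mathrm{vec}(\widetilde X_kF\widetilde X_k+Q).$$ Let $\mathrm{vec}(\widehat X_{k+1})$ be the result of $\overline{it}_k$ iterations of GMRES with zero initial guess for $\widetilde{\mathcal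 A}_kx=b_k$, i.e. the minimizer of $\|b_k-\widetilde{\mathcal A}_kx\|_2$ over the Krylov space $\mathrm{span}\{b_k,\widetilde{\mathcal A}_kb_k,\dots,\widetilde{\mathcal A}_k^{\,\overline{it}_k-1}b_k\}$. Then set $$\widetilde X_{k+1}:=(1-\lambda_k)\widetilde X_k+\lambda_k\widehat X_{k+1}.$$ Without line search, $\lambda_k=1$ for all $k$. With line search (parameter $\alpha>0$), $\lambda_k$ is any number in $(0,1)$ found such that $$\|\mathcal R((1-\lambda_k)\widetilde X_k+\lambda_k\widehat X_{k+1})\|_2\le(1-\lambda_k\alpha)\|\mathcal R(\widetilde X_k)\|_2 .$$ **Theorem.** Let $\mathcal W(L^{-1}AL)\subset\mathbb C^-$ and let $\widetilde X_0$ be symmetric positive semidefinite with $\widetilde A_{cl,0}=A-F\widetilde X_0$ stable. Put $$\widetilde{\mathcal L}_k:=(L^\top\otimes L^\top)\,\widetilde{\mathcal A}_k\,(L^{-\top}\otimes L^{-\top})=I\otimes L^\top\widetilde A_{cl,k}^\top L^{-\top}+L^\top\widetilde A_{cl,k}^\top L^{-\top}\otimes I .$$ Suppose that in each outer iteration performed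 the number of GMRES iterations satisfies $$\overline{it}_k\ \ge\ \frac{2\log\left((1+\sqrt2)\,\dfrac{\kappa(F)\,\|\widetilde X_kF\widetilde X_k+Q\|_F}{\lambda_{\min}(Q)}\right)}{-\log\left(1-\dfrac{\lambda_{\min}^2\big(-(\widetilde{\mathcal L}_k+\widetilde{\mathcal L}_k^\top)/2\big)}{\lambda_{\max}(\widetilde{\mathcal L}_k\widetilde{\mathcal L}_k^\top)}\right)} ,$$ where the right-hand side is read as $0$ if the argument of the logarithm in the denominator is $0$. Then, for any number of outer iterations performed, every iterate $\widetilde X_k$, $k\ge0$ (including the last one), is symmetric and positive semidefinite, and $\widetilde A_{cl,k}=A-F\widetilde X_k$ is stable. Moreover the iteration is well defined: at every iterate $\widetilde{\mathcal A}_k$ is nonsingular and, for every number of inner iterations, the GMRES result $\widehat X_{k+1}$ exists and is unique. -/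

import Mathlib

open scoped Matrix Kronecker

noncomputable section

namespace Tink

variable {n : ℕ} {ι : Type*} [Fintype ι] [DecidableEq ι]

/-- The numerical range `{xᴴ M x : x ∈ ℂⁿ, ‖x‖₂ = 1}` of a complex matrix. -/
def numericalRange (M : Matrix ι ι ℂ) : Set ℂ :=
  {z | ∃ x : EuclideanSpace ℂ ι, ‖x‖ = 1 ∧ z = star (x : ι → ℂ) ⬝ᵥ (M *ᵥ (x : ι → ℂ))}

/-- A real matrix is stable if all its complex eigenvalues lie in the open left half-plane. -/
def IsStable (M : Matrix ι ι ℝ) : Prop :=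
  ∀ μ ∈ spectrum ℂ (M.map (algebraMap ℝ ℂ)), μ.re < 0

/-- The spectral norm `‖M‖₂`. -/
def specNorm (M : Matrix ι ι ℝ) : ℝ :=
  ‖Matrix.toEuclideanCLM (n := ι) (𝕜 := ℝ) M‖

/-- The Frobenius norm `‖M‖_F`. -/
def frobNorm (M : Matrix ι ι ℝ) : ℝ :=
  Real.sqrt (∑ i, ∑ j, M i j ^ 2)

/-- The 2-norm condition number (of an invertible matrix). -/
def cond2 (M : Matrix ι ι ℝ) : ℝ :=
  specNorm M * specNorm M⁻¹

/-- The smallest eigenvalue (of a symmetric matrix). -/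
def lambdaMin (M : Matrix ι ι ℝ) : ℝ :=
  sInf (spectrum ℝ M)

/-- The largest eigenvalue (of a symmetric matrix). -/
def lambdaMax (M : Matrix ι ι ℝ) : ℝ :=
  sSup (spectrum ℝ M)

/-- `L` is the Cholesky factor of `F`: lower triangular with positive diagonal and `F = L Lᵀ`. -/
structure IsCholeskyFactor (L F : Matrix (Fin n) (Fin n) ℝ) : Prop where
  lower : ∀ i j, i < j → L i j = 0
  diag_pos : ∀ i, 0 < L i i
  mul_transpose : L * Lᵀ = F

/-- The Riccati residual `ℛ(X) = Aᵀ X + X A - X F X + Q`. -/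
def riccati (A F Q X : Matrix ι ι ℝ) : Matrix ι ι ℝ :=
  Aᵀ * X + X * A - X * F * X + Q

/-- The closed-loop matrix `A - F X`. -/
def closedLoop (A F X : Matrix ι ι ℝ) : Matrix ι ι ℝ :=
  A - F * X

/-- The `n² × n²` matrix `I ⊗ Cᵀ + Cᵀ ⊗ I` of the Lyapunov operator `X ↦ Cᵀ X + X C`, with respect
to the column-stacking map `Matrix.vec`. -/
def lyapMatrix (C : Matrix ι ι ℝ) : Matrix (ι × ι) (ι × ι) ℝ :=
  (1 : Matrix ι ι ℝ) ⊗ₖ Cᵀ + Cᵀ ⊗ₖ (1 : Matrix ι ι ℝ)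

/-- The matrix `(Lᵀ ⊗ Lᵀ) (I ⊗ Cᵀ + Cᵀ ⊗ I) (L⁻ᵀ ⊗ L⁻ᵀ)`. -/
def scaledLyapMatrix (L C : Matrix ι ι ℝ) : Matrix (ι × ι) (ι × ι) ℝ :=
  (Lᵀ ⊗ₖ Lᵀ) * lyapMatrix C * ((L⁻¹)ᵀ ⊗ₖ (L⁻¹)ᵀ)

/-- The Krylov subspace `span {b, M b, …, M^(m-1) b}`. -/
def krylov (M : Matrix ι ι ℝ) (b : ι → ℝ) (m : ℕ) : Submodule ℝ (ι → ℝ) :=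
  Submodule.span ℝ ((fun j : ℕ => (M ^ j) *ᵥ b) '' {j | j < m})

/-- `x` is the result of `m` iterations of GMRES for `M x = b` with zero initial guess: it minimizes
the Euclidean norm of the residual over the `m`-th Krylov subspace. -/
structure IsGMRESIterate (M : Matrix ι ι ℝ) (b : ι → ℝ) (m : ℕ) (x : ι → ℝ) : Prop where
  mem : x ∈ krylov M b m
  min : ∀ y ∈ krylov M b m,
    ‖(WithLp.toLp 2 (b - M *ᵥ x) : EuclideanSpace ℝ ι)‖ ≤
      ‖(WithLp.toLp 2 (b - M *ᵥ y) : EuclideanSpace ℝ ι)‖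

/-- `Xhat` is obtained by `m` iterations of GMRES on the vectorized Newton–Kleinman equation
`Cᵀ Y + Y C = -(X F X + Q)`, `C = A - F X`, at the current iterate `X`. -/
def IsInnerSolve (A F Q X : Matrix ι ι ℝ) (m : ℕ) (Xhat : Matrix ι ι ℝ) : Prop :=
  IsGMRESIterate (lyapMatrix (closedLoop A F X)) (-(X * F * X + Q).vec) m Xhat.vec

/-- The matrices `X 0, …, X N` are produced by `N` outer iterations of the TINK algorithm without
truncation, with start `X₀`, with `it k` GMRES iterations in the `k`-th outer iteration, inner
solutions `Xhat (k + 1)` and step lengths `lam k`. If the flag `lineSearch` is set, `lam k` is any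
number in `(0, 1)` satisfying the line search condition with parameter `α`; otherwise it is `1`.
The stopping test of the algorithm only determines the number `N` of outer iterations. -/
structure IsRun (A F Q X₀ : Matrix ι ι ℝ) (lineSearch : Bool) (α : ℝ) (N : ℕ) (it : ℕ → ℕ)
    (X Xhat : ℕ → Matrix ι ι ℝ) (lam : ℕ → ℝ) : Prop where
  start : X 0 = X₀
  inner : ∀ k < N, IsInnerSolve A F Q (X k) (it k) (Xhat (k + 1))
  step_search : lineSearch = true → ∀ k < N, 0 < lam k ∧ lam k < 1 ∧
    specNorm (riccati A F Q ((1 - lam k) • X k + lam k • Xhat (k + 1))) ≤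
      (1 - lam k * α) * specNorm (riccati A F Q (X k))
  step_full : lineSearch = false → ∀ k < N, lam k = 1
  update : ∀ k < N, X (k + 1) = (1 - lam k) • X k + lam k • Xhat (k + 1)

/-- The lower bound on the number of GMRES iterations at the iterate `X`. If the argument of the
logarithm in the denominator is `0`, the quotient is `0`, its limit value. -/
def iterBound (A F Q L X : Matrix ι ι ℝ) : ℝ :=
  let S := scaledLyapMatrix L (closedLoop A F X)
  2 * Real.log ((1 + Real.sqrt 2) * (cond2 F * frobNorm (X * F * X + Q) / lambdaMin Q)) /
    (-Real.log (1 - lambdaMin (-((1 / 2 : ℝ) • (S + Sᵀ))) ^ 2 / lambdaMax (S * Sᵀ)))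

end Tink

end

/-!
Conjugation by `L` turns the closed-loop matrix `A - L Lᵀ X` into `L⁻¹ A L - Lᵀ X L`. The first
term has a negative definite quadratic form by the numerical range condition, hence so does the
difference whenever `X` is positive semidefinite; this gives stability and makes the scaled
Lyapunov matrix strictly dissipative.

For a strictly dissipative matrix `M` the Richardson polynomial `(1 + c M) ^ m` is an admissible
GMRES residual polynomial, and for a suitable `c` each factor contracts squared norms by Elman's
factor. Scaling back costs `κ(L)² = κ(F)`, so the bound on the number of inner iterations forces
the residual `R` of the Newton–Kleinman equation to satisfy `‖R‖_F ≤ λ_min(Q)`. The GMRES result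
`Y` therefore solves `Cᵀ Y + Y C = -(X F X + Q + R)` with a negative semidefinite right-hand side,
so `Y` is positive semidefinite, and positive semidefiniteness passes to convex combinations.
-/

noncomputable section

namespace Tink

section Dissipative

variable {ι : Type*}

/-- The negated symmetric part `-(M + Mᵀ) / 2`, whose least eigenvalue measures the strength of the
dissipation of `M`. -/
def negSymmPart (M : Matrix ι ι ℝ) : Matrix ι ι ℝ :=
  -((1 / 2 : ℝ) • (M + Mᵀ))

lemma isHermitian_negSymmPart (M : Matrix ι ι ℝ) : (negSymmPart M).IsHermitian :=
  Matrix.isHermitian_iff_isSymm.2 ((M.isSymm_add_transpose_self.smul _).neg)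

variable [Fintype ι]

lemma dotProduct_self_nonneg (v : ι → ℝ) : 0 ≤ v ⬝ᵥ v := by
  simpa using dotProduct_star_self_nonneg v

lemma dotProduct_self_pos {v : ι → ℝ} (hv : v ≠ 0) : 0 < v ⬝ᵥ v := by
  simpa using Matrix.dotProduct_star_self_pos_iff.2 hv

lemma norm_toLp_sq (v : ι → ℝ) : ‖(WithLp.toLp 2 v : EuclideanSpace ℝ ι)‖ ^ 2 = v ⬝ᵥ v := by
  rw [EuclideanSpace.real_norm_sq_eq]
  simp [dotProduct, sq]

lemma norm_toLp_le_iff (v w : ι → ℝ) :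
    ‖(WithLp.toLp 2 v : EuclideanSpace ℝ ι)‖ ≤ ‖(WithLp.toLp 2 w : EuclideanSpace ℝ ι)‖ ↔
      v ⬝ᵥ v ≤ w ⬝ᵥ w := by
  rw [← norm_toLp_sq, ← norm_toLp_sq, sq_le_sq₀ (norm_nonneg _) (norm_nonneg _)]

lemma dotProduct_negSymmPart_mulVec (M : Matrix ι ι ℝ) (v : ι → ℝ) :
    v ⬝ᵥ negSymmPart M *ᵥ v = -(v ⬝ᵥ M *ᵥ v) := by
  simp only [negSymmPart, Matrix.neg_mulVec, Matrix.smul_mulVec, Matrix.add_mulVec, dotProduct_neg,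
    dotProduct_smul, dotProduct_add, Matrix.dotProduct_transpose_mulVec, smul_eq_mul]
  ring

/-- A real matrix is strictly dissipative if its quadratic form is negative definite; the matrix
need not be symmetric. Such matrices are stable, and GMRES converges linearly for them. -/
def StrictlyDissipative (M : Matrix ι ι ℝ) : Prop :=
  ∀ v : ι → ℝ, v ≠ 0 → v ⬝ᵥ M *ᵥ v < 0

lemma strictlyDissipative_iff_posDef_negSymmPart {M : Matrix ι ι ℝ} :
    StrictlyDissipative M ↔ (negSymmPart M).PosDef := by
  simp only [StrictlyDissipative, Matrix.posDef_iff_dotProduct_mulVec, isHermitian_negSymmPart,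
    true_and, star_trivial, dotProduct_negSymmPart_mulVec, Left.neg_pos_iff, ne_eq]

namespace StrictlyDissipative

variable {M : Matrix ι ι ℝ}

lemma nonpos (h : StrictlyDissipative M) (v : ι → ℝ) : v ⬝ᵥ M *ᵥ v ≤ 0 := by
  rcases eq_or_ne v 0 with rfl | hv
  · simp
  · exact (h v hv).le

lemma mulVec_ne_zero (h : StrictlyDissipative M) {v : ι → ℝ} (hv : v ≠ 0) : M *ᵥ v ≠ 0 :=
  fun h0 => by simpa [h0] using h v hv

lemma isUnit [DecidableEq ι] (h : StrictlyDissipative M) : IsUnit M := by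
  rw [← Matrix.mulVec_injective_iff_isUnit, ← Matrix.coe_mulVecLin, injective_iff_map_eq_zero]
  exact fun v hv => by_contra fun hne => h.mulVec_ne_zero hne hv

end StrictlyDissipative

end Dissipative

section ExtremeEigenvalues

variable {ι : Type*} [Fintype ι] [DecidableEq ι] {M : Matrix ι ι ℝ}

open scoped MatrixOrder in
lemma lambdaMin_mul_le (hM : M.IsHermitian) (v : ι → ℝ) :
    lambdaMin M * (v ⬝ᵥ v) ≤ v ⬝ᵥ M *ᵥ v := by
  have h : algebraMap ℝ _ (lambdaMin M) ≤ M :=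
    algebraMap_le_of_le_spectrum (fun _ hx => csInf_le M.finite_real_spectrum.bddBelow hx)
      hM.isSelfAdjoint
  simpa [Algebra.algebraMap_eq_smul_one, Matrix.sub_mulVec, Matrix.smul_mulVec] using
    (Matrix.le_iff.1 h).dotProduct_mulVec_nonneg v

open scoped MatrixOrder in
lemma le_lambdaMax_mul (hM : M.IsHermitian) (v : ι → ℝ) :
    v ⬝ᵥ M *ᵥ v ≤ lambdaMax M * (v ⬝ᵥ v) := by
  have h : M ≤ algebraMap ℝ _ (lambdaMax M) :=
    le_algebraMap_of_spectrum_le (fun _ hx => le_csSup M.finite_real_spectrum.bddAbove hx)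
      hM.isSelfAdjoint
  simpa [Algebra.algebraMap_eq_smul_one, Matrix.sub_mulVec, Matrix.smul_mulVec] using
    (Matrix.le_iff.1 h).dotProduct_mulVec_nonneg v

lemma lambdaMin_pos [Nonempty ι] (hM : M.PosDef) : 0 < lambdaMin M := by
  have hspec := hM.isHermitian.spectrum_real_eq_range_eigenvalues
  have hmem : lambdaMin M ∈ spectrum ℝ M :=
    (hspec ▸ Set.range_nonempty _ : (spectrum ℝ M).Nonempty).csInf_mem M.finite_real_spectrum
  obtain ⟨i, hi⟩ := hspec ▸ hmem
  exact hi ▸ hM.eigenvalues_pos i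

lemma spectrum_mul_transpose (M : Matrix ι ι ℝ) : spectrum ℝ (M * Mᵀ) = spectrum ℝ (Mᵀ * M) := by
  ext μ
  rw [Matrix.mem_spectrum_iff_isRoot_charpoly, Matrix.mem_spectrum_iff_isRoot_charpoly,
    Matrix.charpoly_mul_comm]

lemma dotProduct_mulVec_self_le_lambdaMax (M : Matrix ι ι ℝ) (v : ι → ℝ) :
    M *ᵥ v ⬝ᵥ M *ᵥ v ≤ lambdaMax (M * Mᵀ) * (v ⬝ᵥ v) := by
  calc M *ᵥ v ⬝ᵥ M *ᵥ v = v ⬝ᵥ (Mᵀ * M) *ᵥ v := by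
        rw [← Matrix.mulVec_mulVec, Matrix.dotProduct_transpose_mulVec]
    _ ≤ lambdaMax (Mᵀ * M) * (v ⬝ᵥ v) :=
        le_lambdaMax_mul (by simpa using Matrix.isHermitian_conjTranspose_mul_self M) v
    _ = lambdaMax (M * Mᵀ) * (v ⬝ᵥ v) := by rw [lambdaMax, lambdaMax, spectrum_mul_transpose]

lemma StrictlyDissipative.lambdaMin_pos [Nonempty ι] (h : StrictlyDissipative M) :
    0 < lambdaMin (negSymmPart M) :=
  Tink.lambdaMin_pos (strictlyDissipative_iff_posDef_negSymmPart.1 h)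

lemma StrictlyDissipative.lambdaMax_pos [Nonempty ι] (h : StrictlyDissipative M) :
    0 < lambdaMax (M * Mᵀ) := by
  obtain ⟨v, hv⟩ := exists_ne (0 : ι → ℝ)
  exact pos_of_mul_pos_left
    ((dotProduct_self_pos (h.mulVec_ne_zero hv)).trans_le (dotProduct_mulVec_self_le_lambdaMax M v))
    (dotProduct_self_nonneg v)

end ExtremeEigenvalues

section MatrixNorms

variable {ι : Type*} [Fintype ι]

lemma frobNorm_nonneg (M : Matrix ι ι ℝ) : 0 ≤ frobNorm M := Real.sqrt_nonneg _

lemma frobNorm_sq (M : Matrix ι ι ℝ) : frobNorm M ^ 2 = M.vec ⬝ᵥ M.vec := by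
  rw [frobNorm, Real.sq_sqrt (by positivity), Finset.sum_comm]
  simp [dotProduct, Fintype.sum_prod_type, sq]

lemma frobNorm_transpose (M : Matrix ι ι ℝ) : frobNorm Mᵀ = frobNorm M := by
  rw [frobNorm, frobNorm, Finset.sum_comm]
  rfl

lemma frobNorm_neg (M : Matrix ι ι ℝ) : frobNorm (-M) = frobNorm M := by
  simp only [frobNorm, Matrix.neg_apply, neg_sq]

lemma abs_dotProduct_mulVec_le_frobNorm (M : Matrix ι ι ℝ) (v : ι → ℝ) :
    |v ⬝ᵥ M *ᵥ v| ≤ frobNorm M * (v ⬝ᵥ v) := by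
  refine abs_le_of_sq_le_sq ?_ (mul_nonneg (frobNorm_nonneg M) (dotProduct_self_nonneg v))
  have hform : v ⬝ᵥ M *ᵥ v = ∑ p : ι × ι, M p.1 p.2 * (v p.1 * v p.2) := by
    simp only [dotProduct, Matrix.mulVec, Fintype.sum_prod_type, Finset.mul_sum]
    exact Finset.sum_congr rfl fun i _ => Finset.sum_congr rfl fun j _ => by ring
  have hnorm : (v ⬝ᵥ v) ^ 2 = ∑ p : ι × ι, (v p.1 * v p.2) ^ 2 := by
    simp only [dotProduct, Fintype.sum_prod_type, sq, Finset.sum_mul_sum]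
    exact Finset.sum_congr rfl fun i _ => Finset.sum_congr rfl fun j _ => by ring
  have hfrob : frobNorm M ^ 2 = ∑ p : ι × ι, M p.1 p.2 ^ 2 := by
    rw [frobNorm, Real.sq_sqrt (by positivity), Fintype.sum_prod_type]
  rw [mul_pow, hform, hnorm, hfrob]
  exact Finset.sum_mul_sq_le_sq_mul_sq _ _ _

variable [DecidableEq ι]

lemma posSemidef_add_of_frobNorm_le_lambdaMin {Q R : Matrix ι ι ℝ} (hQ : Q.IsHermitian)
    (hR : R.IsHermitian) (h : frobNorm R ≤ lambdaMin Q) : (Q + R).PosSemidef := by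
  refine .of_dotProduct_mulVec_nonneg (hQ.add hR) fun v => ?_
  have hQv := lambdaMin_mul_le hQ v
  have hRv := (abs_le.1 (abs_dotProduct_mulVec_le_frobNorm R v)).1
  have hle := mul_le_mul_of_nonneg_right h (dotProduct_self_nonneg v)
  rw [star_trivial, Matrix.add_mulVec, dotProduct_add]
  linarith

lemma specNorm_nonneg (M : Matrix ι ι ℝ) : 0 ≤ specNorm M := norm_nonneg _

open scoped Matrix.Norms.L2Operator in
lemma specNorm_transpose (M : Matrix ι ι ℝ) : specNorm Mᵀ = specNorm M := by
  rw [← Matrix.conjTranspose_eq_transpose_of_trivial]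
  exact Matrix.l2_opNorm_conjTranspose M

open scoped Matrix.Norms.L2Operator in
lemma specNorm_transpose_mul_self (M : Matrix ι ι ℝ) : specNorm (Mᵀ * M) = specNorm M ^ 2 := by
  rw [← Matrix.conjTranspose_eq_transpose_of_trivial, sq]
  exact Matrix.l2_opNorm_conjTranspose_mul_self M

lemma cond2_mul_transpose_self (L : Matrix ι ι ℝ) : cond2 (L * Lᵀ) = cond2 L ^ 2 := by
  have hL : specNorm (L * Lᵀ) = specNorm L ^ 2 := by
    simpa [specNorm_transpose] using specNorm_transpose_mul_self Lᵀ
  have hLinv : specNorm (L * Lᵀ)⁻¹ = specNorm L⁻¹ ^ 2 := by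
    rw [Matrix.mul_inv_rev, ← Matrix.transpose_nonsing_inv, specNorm_transpose_mul_self]
  rw [cond2, hL, hLinv, ← mul_pow, cond2]

lemma dotProduct_mulVec_self_le_specNorm (M : Matrix ι ι ℝ) (v : ι → ℝ) :
    M *ᵥ v ⬝ᵥ M *ᵥ v ≤ specNorm M ^ 2 * (v ⬝ᵥ v) := by
  rw [← norm_toLp_sq, ← norm_toLp_sq, ← mul_pow, ← Matrix.toEuclideanCLM_toLp]
  exact pow_le_pow_left₀ (norm_nonneg _) (ContinuousLinearMap.le_opNorm _ _) 2

lemma frobNorm_mul_le (M Y : Matrix ι ι ℝ) : frobNorm (M * Y) ≤ specNorm M * frobNorm Y := by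
  rw [← sq_le_sq₀ (frobNorm_nonneg _) (mul_nonneg (specNorm_nonneg _) (frobNorm_nonneg _)),
    mul_pow, frobNorm_sq, frobNorm_sq]
  simp only [dotProduct, Fintype.sum_prod_type, Finset.mul_sum (s := Finset.univ)]
  refine Finset.sum_le_sum fun j _ => ?_
  simpa [dotProduct, Finset.mul_sum, Matrix.mulVec, Matrix.mul_apply, Matrix.vec] using
    dotProduct_mulVec_self_le_specNorm M fun i => Y i j

lemma frobNorm_transpose_mul_mul_le (L B : Matrix ι ι ℝ) :
    frobNorm (Lᵀ * B * L) ≤ specNorm L ^ 2 * frobNorm B := by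
  calc frobNorm (Lᵀ * B * L) ≤ specNorm L * frobNorm (B * L) := by
        rw [Matrix.mul_assoc, ← specNorm_transpose L]
        exact frobNorm_mul_le _ _
    _ = specNorm L * frobNorm (Lᵀ * Bᵀ) := by
        rw [← frobNorm_transpose (B * L), Matrix.transpose_mul]
    _ ≤ specNorm L * (specNorm L * frobNorm B) := by
        rw [← frobNorm_transpose B, ← specNorm_transpose L]
        exact mul_le_mul_of_nonneg_left (frobNorm_mul_le _ _) (specNorm_nonneg _)
    _ = specNorm L ^ 2 * frobNorm B := by ring

lemma frobNorm_le_of_isUnit {L : Matrix ι ι ℝ} (hL : IsUnit L) (R : Matrix ι ι ℝ) :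
    frobNorm R ≤ specNorm L⁻¹ ^ 2 * frobNorm (Lᵀ * R * L) := by
  have hLd : IsUnit L.det := L.isUnit_iff_isUnit_det.1 hL
  have hR : (L⁻¹)ᵀ * (Lᵀ * R * L) * L⁻¹ = R := by
    rw [Matrix.transpose_nonsing_inv, ← Matrix.mul_assoc,
      Matrix.mul_nonsing_inv_cancel_right _ _ hLd,
      Matrix.nonsing_inv_mul_cancel_left _ _ (by simpa using hLd)]
  simpa only [hR] using frobNorm_transpose_mul_mul_le L⁻¹ (Lᵀ * R * L)

end MatrixNorms

section Elman

variable {ι : Type*} [Fintype ι]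

lemma dotProduct_add_smul_self_le {x y : ι → ℝ} {a b : ℝ} (ha : 0 ≤ a) (hb : 0 < b)
    (hxy : a * (x ⬝ᵥ x) ≤ -(x ⬝ᵥ y)) (hyy : y ⬝ᵥ y ≤ b * (x ⬝ᵥ x)) :
    (x + (a / b) • y) ⬝ᵥ (x + (a / b) • y) ≤ (1 - a ^ 2 / b) * (x ⬝ᵥ x) := by
  calc (x + (a / b) • y) ⬝ᵥ (x + (a / b) • y)
      = x ⬝ᵥ x + 2 * (a / b) * (x ⬝ᵥ y) + (a / b) ^ 2 * (y ⬝ᵥ y) := by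
        simp only [add_dotProduct, dotProduct_add, smul_dotProduct, dotProduct_smul, smul_eq_mul,
          dotProduct_comm y x]
        ring
    _ ≤ x ⬝ᵥ x + 2 * (a / b) * -(a * (x ⬝ᵥ x)) + (a / b) ^ 2 * (b * (x ⬝ᵥ x)) := by
        gcongr
        linarith
    _ = (1 - a ^ 2 / b) * (x ⬝ᵥ x) := by
        field_simp
        ring

variable [DecidableEq ι]

lemma dotProduct_pow_mulVec_self_le {T : Matrix ι ι ℝ} {ρ : ℝ} (hρ : 0 ≤ ρ)
    (hT : ∀ v, T *ᵥ v ⬝ᵥ T *ᵥ v ≤ ρ * (v ⬝ᵥ v)) (m : ℕ) (v : ι → ℝ) :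
    (T ^ m) *ᵥ v ⬝ᵥ (T ^ m) *ᵥ v ≤ ρ ^ m * (v ⬝ᵥ v) := by
  induction m with
  | zero => simp
  | succ m ih =>
    rw [pow_succ', ← Matrix.mulVec_mulVec, pow_succ', mul_assoc]
    exact (hT _).trans (mul_le_mul_of_nonneg_left ih hρ)

/-- Elman's squared contraction factor `1 - λ_min(-(M + Mᵀ) / 2)² / λ_max(M Mᵀ)` for one step of
a minimal residual method applied to a strictly dissipative matrix. -/
def elmanFactor (M : Matrix ι ι ℝ) : ℝ :=
  1 - lambdaMin (negSymmPart M) ^ 2 / lambdaMax (M * Mᵀ)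

/-- The step length `c` for which the Richardson residual map `1 + c • M` contracts squared norms
by `elmanFactor M`. -/
def elmanStep (M : Matrix ι ι ℝ) : ℝ :=
  lambdaMin (negSymmPart M) / lambdaMax (M * Mᵀ)

namespace StrictlyDissipative

variable [Nonempty ι] {M : Matrix ι ι ℝ}

lemma dotProduct_richardson_le (h : StrictlyDissipative M) (v : ι → ℝ) :
    (1 + elmanStep M • M) *ᵥ v ⬝ᵥ (1 + elmanStep M • M) *ᵥ v ≤ elmanFactor M * (v ⬝ᵥ v) := by
  rw [Matrix.add_mulVec, Matrix.one_mulVec, Matrix.smul_mulVec]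
  refine dotProduct_add_smul_self_le h.lambdaMin_pos.le h.lambdaMax_pos ?_
    (dotProduct_mulVec_self_le_lambdaMax M v)
  rw [← dotProduct_negSymmPart_mulVec]
  exact lambdaMin_mul_le (isHermitian_negSymmPart M) v

lemma elmanFactor_nonneg (h : StrictlyDissipative M) : 0 ≤ elmanFactor M := by
  obtain ⟨v, hv⟩ := exists_ne (0 : ι → ℝ)
  exact nonneg_of_mul_nonneg_left
    ((dotProduct_self_nonneg _).trans (h.dotProduct_richardson_le v)) (dotProduct_self_pos hv)

lemma elmanFactor_lt_one (h : StrictlyDissipative M) : elmanFactor M < 1 :=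
  sub_lt_self _ (div_pos (pow_pos h.lambdaMin_pos 2) h.lambdaMax_pos)

lemma dotProduct_richardson_pow_le (h : StrictlyDissipative M) (m : ℕ) (v : ι → ℝ) :
    ((1 + elmanStep M • M) ^ m) *ᵥ v ⬝ᵥ ((1 + elmanStep M • M) ^ m) *ᵥ v ≤
      elmanFactor M ^ m * (v ⬝ᵥ v) :=
  dotProduct_pow_mulVec_self_le h.elmanFactor_nonneg h.dotProduct_richardson_le m v

end StrictlyDissipative

end Elman

lemma norm_sub_le_forall_iff_eq_starProjection {𝕜 E : Type*} [RCLike 𝕜] [NormedAddCommGroup E]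
    [InnerProductSpace 𝕜 E] {W : Submodule 𝕜 E} [W.HasOrthogonalProjection] {v w : E}
    (hw : w ∈ W) : (∀ z ∈ W, ‖v - w‖ ≤ ‖v - z‖) ↔ w = W.starProjection v := by
  have hbdd : BddBelow (Set.range fun z : W => ‖v - z‖) :=
    ⟨0, Set.forall_mem_range.2 fun _ => norm_nonneg _⟩
  have hmin : (∀ z ∈ W, ‖v - w‖ ≤ ‖v - z‖) ↔ ‖v - w‖ = ⨅ z : W, ‖v - z‖ := by
    rw [le_antisymm_iff, and_iff_left (ciInf_le hbdd ⟨w, hw⟩), le_ciInf_iff hbdd, Subtype.forall]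
  rw [hmin, W.norm_eq_iInf_iff_inner_eq_zero hw]
  refine ⟨fun h => (Submodule.eq_starProjection_of_mem_of_inner_eq_zero hw h).symm, ?_⟩
  rintro rfl
  exact Submodule.starProjection_inner_eq_zero v

section GMRES

variable {ι : Type*} [Fintype ι] [DecidableEq ι] {M : Matrix ι ι ℝ} {b : ι → ℝ} {m : ℕ}

lemma krylov_mono (M : Matrix ι ι ℝ) (b : ι → ℝ) : Monotone (krylov M b) :=
  fun _ _ h => Submodule.span_mono (Set.image_mono fun _ hj => lt_of_lt_of_le hj h)

lemma krylov_le_of_invariant {V : Submodule ℝ (ι → ℝ)} (hb : b ∈ V)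
    (hV : ∀ x ∈ V, M *ᵥ x ∈ V) (m : ℕ) : krylov M b m ≤ V := by
  refine Submodule.span_le.2 ?_
  rintro _ ⟨j, -, rfl⟩
  induction j with
  | zero => simpa using hb
  | succ j ih => simpa only [pow_succ', ← Matrix.mulVec_mulVec, SetLike.mem_coe] using hV _ ih

lemma mulVec_mem_krylov_succ {y : ι → ℝ} (hy : y ∈ krylov M b m) :
    M *ᵥ y ∈ krylov M b (m + 1) := by
  have hle : krylov M b m ≤ (krylov M b (m + 1)).comap M.mulVecLin := by
    refine Submodule.span_le.2 ?_
    rintro _ ⟨j, hj, rfl⟩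
    exact Submodule.subset_span
      ⟨j + 1, Nat.succ_lt_succ hj, by simp [pow_succ', Matrix.mulVec_mulVec]⟩
  exact hle hy

lemma exists_mem_krylov_residual (M : Matrix ι ι ℝ) (b : ι → ℝ) (c : ℝ) (m : ℕ) :
    ∃ y ∈ krylov M b m, b - M *ᵥ y = ((1 + c • M) ^ m) *ᵥ b := by
  induction m with
  | zero => exact ⟨0, Submodule.zero_mem _, by simp⟩
  | succ m ih =>
    obtain ⟨y, hy, hres⟩ := ih
    have hb : b ∈ krylov M b (m + 1) := Submodule.subset_span ⟨0, m.succ_pos, by simp⟩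
    refine ⟨y - c • (b - M *ᵥ y), sub_mem (krylov_mono M b m.le_succ hy)
      (Submodule.smul_mem _ _ (sub_mem hb (mulVec_mem_krylov_succ hy))), ?_⟩
    rw [pow_succ', ← Matrix.mulVec_mulVec, ← hres, Matrix.add_mulVec, Matrix.one_mulVec,
      Matrix.smul_mulVec, Matrix.mulVec_sub, Matrix.mulVec_smul]
    abel

lemma IsGMRESIterate.dotProduct_residual_le {x : ι → ℝ} (hx : IsGMRESIterate M b m x) (c : ℝ) :
    (b - M *ᵥ x) ⬝ᵥ (b - M *ᵥ x) ≤ ((1 + c • M) ^ m) *ᵥ b ⬝ᵥ ((1 + c • M) ^ m) *ᵥ b := by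
  obtain ⟨y, hy, hres⟩ := exists_mem_krylov_residual M b c m
  rw [← hres, ← norm_toLp_le_iff]
  exact hx.min y hy

/-- The image of the Krylov space under `M`, the space in which GMRES approximates the right-hand
side; it is placed in `EuclideanSpace` so that orthogonal projections apply. -/
def krylovImage (M : Matrix ι ι ℝ) (b : ι → ℝ) (m : ℕ) : Submodule ℝ (EuclideanSpace ℝ ι) :=
  (krylov M b m).map ((WithLp.linearEquiv 2 ℝ (ι → ℝ)).symm.toLinearMap ∘ₗ M.mulVecLin)

lemma isGMRESIterate_iff {x : ι → ℝ} :
    IsGMRESIterate M b m x ↔ x ∈ krylov M b m ∧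
      WithLp.toLp 2 (M *ᵥ x) = (krylovImage M b m).starProjection (WithLp.toLp 2 b) := by
  have himage : ∀ y ∈ krylov M b m, WithLp.toLp 2 (M *ᵥ y) ∈ krylovImage M b m :=
    fun y hy => ⟨y, hy, rfl⟩
  refine Iff.trans ⟨fun h => ⟨h.mem, h.min⟩, fun h => ⟨h.1, h.2⟩⟩ (and_congr_right fun hx => ?_)
  simp only [← norm_sub_le_forall_iff_eq_starProjection (himage x hx), WithLp.toLp_sub]
  refine ⟨?_, fun h y hy => h (WithLp.toLp 2 (M *ᵥ y)) (himage y hy)⟩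
  rintro h _ ⟨y, hy, rfl⟩
  exact h y hy

lemma existsUnique_isGMRESIterate (hM : IsUnit M) (b : ι → ℝ) (m : ℕ) :
    ∃! x, IsGMRESIterate M b m x := by
  obtain ⟨x, hx, hproj⟩ := (krylovImage M b m).starProjection_apply_mem (WithLp.toLp 2 b)
  refine ⟨x, isGMRESIterate_iff.2 ⟨hx, hproj⟩, fun z hz => ?_⟩
  exact Matrix.mulVec_injective_of_isUnit hM
    (WithLp.toLp_injective 2 ((isGMRESIterate_iff.1 hz).2.trans hproj.symm))

end GMRES

lemma negSymmPart_lyapMatrix {ι : Type*} [DecidableEq ι] (K : Matrix ι ι ℝ) :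
    negSymmPart (lyapMatrix K) = 1 ⊗ₖ negSymmPart K + negSymmPart K ⊗ₖ 1 := by
  ext ⟨i, j⟩ ⟨k, l⟩
  simp only [negSymmPart, lyapMatrix, Matrix.neg_apply, Matrix.smul_apply, Matrix.add_apply,
    Matrix.transpose_apply, Matrix.kronecker_apply, smul_eq_mul, Matrix.one_apply, eq_comm (a := k),
    eq_comm (a := l)]
  ring

lemma StrictlyDissipative.posSemidef_of_lyapunov {ι : Type*} [Fintype ι] {K Z : Matrix ι ι ℝ}
    (hK : StrictlyDissipative K) (hZ : Z.IsHermitian) (h : (-(Kᵀ * Z + Z * K)).PosSemidef) :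
    Z.PosSemidef := by
  classical
  rw [hZ.posSemidef_iff_eigenvalues_nonneg]
  intro i
  set v : ι → ℝ := WithLp.ofLp (hZ.eigenvectorBasis i)
  have hv : v ≠ 0 := by
    simpa [v] using hZ.eigenvectorBasis.orthonormal.ne_zero i
  have hev : Z *ᵥ v = hZ.eigenvalues i • v := hZ.mulVec_eigenvectorBasis i
  have hform : v ⬝ᵥ (Kᵀ * Z + Z * K) *ᵥ v = 2 * hZ.eigenvalues i * (v ⬝ᵥ K *ᵥ v) := by
    calc v ⬝ᵥ (Kᵀ * Z + Z * K) *ᵥ v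
        = v ⬝ᵥ Kᵀ *ᵥ (Z *ᵥ v) + v ⬝ᵥ Zᵀ *ᵥ (K *ᵥ v) := by
          rw [Matrix.isHermitian_iff_isSymm.1 hZ, Matrix.add_mulVec, dotProduct_add,
            Matrix.mulVec_mulVec, Matrix.mulVec_mulVec]
      _ = 2 * hZ.eigenvalues i * (v ⬝ᵥ K *ᵥ v) := by
          rw [Matrix.dotProduct_transpose_mulVec, Matrix.dotProduct_transpose_mulVec, hev,
            smul_dotProduct, dotProduct_smul, dotProduct_comm (K *ᵥ v), smul_eq_mul]
          ring
  have hnonneg := h.dotProduct_mulVec_nonneg v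
  rw [star_trivial, Matrix.neg_mulVec, dotProduct_neg, hform] at hnonneg
  by_contra hneg
  nlinarith [mul_pos_of_neg_of_neg (not_le.1 hneg) (hK v hv)]

section Lyapunov

variable {ι : Type*} [Fintype ι] [DecidableEq ι] {L C K : Matrix ι ι ℝ}

lemma lyapMatrix_mulVec_vec (C Y : Matrix ι ι ℝ) :
    lyapMatrix C *ᵥ Y.vec = (Cᵀ * Y + Y * C).vec := by
  simp [lyapMatrix, Matrix.add_mulVec, Matrix.kronecker_mulVec_vec]

lemma isSymm_of_vec_mem_krylov_lyapMatrix {B Y : Matrix ι ι ℝ} (hB : B.IsSymm) {m : ℕ}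
    (hY : Y.vec ∈ krylov (lyapMatrix C) B.vec m) : Y.IsSymm := by
  let V : Submodule ℝ (ι × ι → ℝ) :=
    LinearMap.eqLocus (LinearMap.funLeft ℝ ℝ Prod.swap) LinearMap.id
  have hV : ∀ Z : Matrix ι ι ℝ, Z.vec ∈ V ↔ Z.IsSymm := fun Z => by
    change Z.vec ∘ Prod.swap = Z.vec ↔ _
    rw [← Matrix.vec_transpose, Matrix.vec_inj, Matrix.IsSymm]
  refine (hV Y).1 (krylov_le_of_invariant ((hV B).2 hB) (fun z hz => ?_) m hY)
  obtain ⟨Z, rfl⟩ := Matrix.vec_bijective.surjective z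
  rw [hV] at hz
  rw [lyapMatrix_mulVec_vec, hV, Matrix.IsSymm]
  simp [hz.eq, add_comm]

lemma StrictlyDissipative.lyapMatrix (hK : StrictlyDissipative K) :
    StrictlyDissipative (lyapMatrix K) := by
  rw [strictlyDissipative_iff_posDef_negSymmPart] at hK ⊢
  rw [negSymmPart_lyapMatrix]
  exact (Matrix.PosDef.one.kronecker hK).add (hK.kronecker Matrix.PosDef.one)

lemma scaledLyapMatrix_eq (hL : IsUnit L) (C : Matrix ι ι ℝ) :
    scaledLyapMatrix L C = lyapMatrix (L⁻¹ * C * L) := by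
  have hinv : Lᵀ * (L⁻¹)ᵀ = 1 := by
    rw [← Matrix.transpose_mul, Matrix.nonsing_inv_mul _ (L.isUnit_iff_isUnit_det.1 hL),
      Matrix.transpose_one]
  simp only [scaledLyapMatrix, lyapMatrix, mul_add, add_mul, ← Matrix.mul_kronecker_mul, mul_one,
    hinv, Matrix.transpose_mul, mul_assoc]

lemma semiconjBy_lyapMatrix (hL : IsUnit L) (C : Matrix ι ι ℝ) :
    SemiconjBy (Lᵀ ⊗ₖ Lᵀ) (lyapMatrix C) (scaledLyapMatrix L C) := by
  have hinv : (L⁻¹)ᵀ * Lᵀ = 1 := by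
    rw [← Matrix.transpose_mul, Matrix.mul_nonsing_inv _ (L.isUnit_iff_isUnit_det.1 hL),
      Matrix.transpose_one]
  rw [SemiconjBy, scaledLyapMatrix, mul_assoc _ _ (Lᵀ ⊗ₖ Lᵀ), ← Matrix.mul_kronecker_mul, hinv,
    Matrix.one_kronecker_one, mul_one]

lemma StrictlyDissipative.scaledLyapMatrix (hL : IsUnit L)
    (hK : StrictlyDissipative (L⁻¹ * C * L)) : StrictlyDissipative (scaledLyapMatrix L C) :=
  scaledLyapMatrix_eq hL C ▸ hK.lyapMatrix

lemma isUnit_lyapMatrix (hL : IsUnit L) (hK : StrictlyDissipative (L⁻¹ * C * L)) :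
    IsUnit (lyapMatrix C) := by
  have hS := (StrictlyDissipative.scaledLyapMatrix hL hK).isUnit
  simp only [scaledLyapMatrix, Matrix.isUnit_iff_isUnit_det, IsUnit.mul_iff] at hS
  exact (Matrix.isUnit_iff_isUnit_det _).2 hS.1.2

lemma existsUnique_isInnerSolve {A F Q X : Matrix ι ι ℝ}
    (h : IsUnit (lyapMatrix (closedLoop A F X))) (m : ℕ) :
    ∃! Y : Matrix ι ι ℝ, IsInnerSolve A F Q X m Y :=
  Matrix.vec_bijective.existsUnique_iff.1 (existsUnique_isGMRESIterate h _ m)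

lemma frobNorm_scaled_richardson_sq_le [Nonempty ι] (hL : IsUnit L)
    (hK : StrictlyDissipative (L⁻¹ * C * L)) {B R : Matrix ι ι ℝ} {m : ℕ}
    (hR : R.vec = ((1 + elmanStep (scaledLyapMatrix L C) • lyapMatrix C) ^ m) *ᵥ B.vec) :
    frobNorm (Lᵀ * R * L) ^ 2 ≤
      elmanFactor (scaledLyapMatrix L C) ^ m * frobNorm (Lᵀ * B * L) ^ 2 := by
  have hvec : ∀ Z : Matrix ι ι ℝ, (Lᵀ * Z * L).vec = (Lᵀ ⊗ₖ Lᵀ) *ᵥ Z.vec := fun Z => by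
    rw [Matrix.kronecker_mulVec_vec, Matrix.transpose_transpose]
  have hsemi : SemiconjBy (Lᵀ ⊗ₖ Lᵀ) (1 + elmanStep (scaledLyapMatrix L C) • lyapMatrix C)
      (1 + elmanStep (scaledLyapMatrix L C) • scaledLyapMatrix L C) :=
    (SemiconjBy.one_right _).add_right ((semiconjBy_lyapMatrix hL C).smul_right _)
  rw [frobNorm_sq, frobNorm_sq, hvec, hvec, hR, Matrix.mulVec_mulVec, (hsemi.pow_right m).eq,
    ← Matrix.mulVec_mulVec]
  exact (StrictlyDissipative.scaledLyapMatrix hL hK).dotProduct_richardson_pow_le m _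

lemma frobNorm_residual_sq_le [Nonempty ι] (hL : IsUnit L)
    (hK : StrictlyDissipative (L⁻¹ * C * L)) {B Y : Matrix ι ι ℝ} {m : ℕ}
    (hY : IsGMRESIterate (lyapMatrix C) B.vec m Y.vec) :
    frobNorm (B - (Cᵀ * Y + Y * C)) ^ 2 ≤
      elmanFactor (scaledLyapMatrix L C) ^ m * (cond2 (L * Lᵀ) * frobNorm B) ^ 2 := by
  have hρ : 0 ≤ elmanFactor (scaledLyapMatrix L C) :=
    (StrictlyDissipative.scaledLyapMatrix hL hK).elmanFactor_nonneg
  obtain ⟨R, hR⟩ := Matrix.vec_bijective.surjective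
    (((1 + elmanStep (scaledLyapMatrix L C) • lyapMatrix C) ^ m) *ᵥ B.vec)
  have hres := hY.dotProduct_residual_le (elmanStep (scaledLyapMatrix L C))
  rw [lyapMatrix_mulVec_vec, ← Matrix.vec_sub, ← hR, ← frobNorm_sq, ← frobNorm_sq] at hres
  calc frobNorm (B - (Cᵀ * Y + Y * C)) ^ 2
      ≤ frobNorm R ^ 2 := hres
    _ ≤ (specNorm L⁻¹ ^ 2 * frobNorm (Lᵀ * R * L)) ^ 2 :=
        pow_le_pow_left₀ (frobNorm_nonneg _) (frobNorm_le_of_isUnit hL R) 2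
    _ = (specNorm L⁻¹ ^ 2) ^ 2 * frobNorm (Lᵀ * R * L) ^ 2 := mul_pow _ _ _
    _ ≤ (specNorm L⁻¹ ^ 2) ^ 2 *
          (elmanFactor (scaledLyapMatrix L C) ^ m * frobNorm (Lᵀ * B * L) ^ 2) := by
        gcongr
        exact frobNorm_scaled_richardson_sq_le hL hK hR
    _ ≤ (specNorm L⁻¹ ^ 2) ^ 2 *
          (elmanFactor (scaledLyapMatrix L C) ^ m * (specNorm L ^ 2 * frobNorm B) ^ 2) := by
        gcongr
        · exact frobNorm_nonneg _
        · exact frobNorm_transpose_mul_mul_le L B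
    _ = elmanFactor (scaledLyapMatrix L C) ^ m * (cond2 (L * Lᵀ) * frobNorm B) ^ 2 := by
        rw [cond2_mul_transpose_self, cond2]
        ring

lemma posSemidef_of_lyapunov {Y : Matrix ι ι ℝ} (hL : IsUnit L)
    (hK : StrictlyDissipative (L⁻¹ * C * L)) (hY : Y.IsHermitian)
    (h : (-(Cᵀ * Y + Y * C)).PosSemidef) : Y.PosSemidef := by
  have hLd : IsUnit L.det := L.isUnit_iff_isUnit_det.1 hL
  have hCL : L * (L⁻¹ * C * L) = C * L := by
    rw [← Matrix.mul_assoc, Matrix.mul_nonsing_inv_cancel_left _ _ hLd]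
  have hcongr : (L⁻¹ * C * L)ᵀ * (Lᵀ * Y * L) + Lᵀ * Y * L * (L⁻¹ * C * L) =
      Lᵀ * (Cᵀ * Y + Y * C) * L := by
    calc (L⁻¹ * C * L)ᵀ * (Lᵀ * Y * L) + Lᵀ * Y * L * (L⁻¹ * C * L)
        = (L * (L⁻¹ * C * L))ᵀ * (Y * L) + Lᵀ * Y * (L * (L⁻¹ * C * L)) := by
          rw [Matrix.transpose_mul L]
          simp only [Matrix.mul_assoc]
      _ = Lᵀ * (Cᵀ * Y + Y * C) * L := by
          rw [hCL, Matrix.transpose_mul]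
          simp only [Matrix.mul_add, Matrix.add_mul, Matrix.mul_assoc]
  have hZ : (Lᵀ * Y * L).PosSemidef := by
    refine hK.posSemidef_of_lyapunov
      (by simpa using Matrix.isHermitian_conjTranspose_mul_mul L hY) ?_
    rw [hcongr, ← Matrix.neg_mul, ← Matrix.mul_neg,
      ← Matrix.conjTranspose_eq_transpose_of_trivial L]
    exact h.conjTranspose_mul_mul_same L
  rwa [← Matrix.conjTranspose_eq_transpose_of_trivial, ← Matrix.star_eq_conjTranspose,
    Matrix.IsUnit.posSemidef_star_left_conjugate_iff hL] at hZ

end Lyapunov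

section Stability

variable {ι : Type*} [Fintype ι]

lemma re_star_dotProduct_map_mulVec (M : Matrix ι ι ℝ) (w : ι → ℂ) :
    (star w ⬝ᵥ M.map (algebraMap ℝ ℂ) *ᵥ w).re =
      (fun i => (w i).re) ⬝ᵥ M *ᵥ (fun i => (w i).re) +
        (fun i => (w i).im) ⬝ᵥ M *ᵥ (fun i => (w i).im) := by
  simp [dotProduct, Matrix.mulVec, Complex.re_sum, Complex.im_sum, Finset.sum_add_distrib]

lemma re_star_dotProduct_mulVec_neg_of_numericalRange {M : Matrix ι ι ℂ}
    (h : numericalRange M ⊆ {z : ℂ | z.re < 0}) {w : ι → ℂ} (hw : w ≠ 0) :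
    (star w ⬝ᵥ M *ᵥ w).re < 0 := by
  set x : EuclideanSpace ℂ ι := WithLp.toLp 2 w
  have hx : x ≠ 0 := by simpa [x] using hw
  have hunit : ‖((‖x‖⁻¹ : ℝ) : ℂ) • x‖ = 1 := by simpa using norm_smul_inv_norm (𝕜 := ℂ) hx
  have hneg : (star (((‖x‖⁻¹ : ℝ) : ℂ) • w) ⬝ᵥ M *ᵥ (((‖x‖⁻¹ : ℝ) : ℂ) • w)).re < 0 :=
    h ⟨_, hunit, rfl⟩
  rw [star_smul, Matrix.mulVec_smul, smul_dotProduct, dotProduct_smul, smul_eq_mul, smul_eq_mul,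
    Complex.star_def, Complex.conj_ofReal, Complex.re_ofReal_mul, Complex.re_ofReal_mul,
    ← mul_assoc] at hneg
  exact neg_of_mul_neg_right hneg (by positivity)

lemma strictlyDissipative_of_numericalRange {M : Matrix ι ι ℝ}
    (h : numericalRange (M.map (algebraMap ℝ ℂ)) ⊆ {z : ℂ | z.re < 0}) :
    StrictlyDissipative M := fun v hv => by
  have hw : (fun i => (v i : ℂ)) ≠ 0 := fun h0 => hv (funext fun i => by simpa using congrFun h0 i)
  have hneg := re_star_dotProduct_mulVec_neg_of_numericalRange h hw
  rw [re_star_dotProduct_map_mulVec] at hneg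
  simpa [← Pi.zero_def] using hneg

lemma StrictlyDissipative.re_star_dotProduct_neg {M : Matrix ι ι ℝ} (h : StrictlyDissipative M)
    {w : ι → ℂ} (hw : w ≠ 0) : (star w ⬝ᵥ M.map (algebraMap ℝ ℂ) *ᵥ w).re < 0 := by
  rw [re_star_dotProduct_map_mulVec]
  rcases ne_or_eq (fun i => (w i).re) 0 with hre | hre
  · exact add_neg_of_neg_of_nonpos (h _ hre) (h.nonpos _)
  · refine add_neg_of_nonpos_of_neg (h.nonpos _) (h _ fun him => hw ?_)
    exact funext fun i => Complex.ext (congrFun hre i) (congrFun him i)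

variable [DecidableEq ι]

open scoped ComplexOrder in
lemma StrictlyDissipative.isStable {M : Matrix ι ι ℝ} (h : StrictlyDissipative M) :
    IsStable M := by
  intro μ hμ
  rw [← Matrix.spectrum_toLin', ← Module.End.hasEigenvalue_iff_mem_spectrum] at hμ
  obtain ⟨w, hw, hw0⟩ := hμ.exists_hasEigenvector
  rw [Module.End.mem_eigenspace_iff, Matrix.toLin'_apply] at hw
  have hneg := h.re_star_dotProduct_neg hw0
  obtain ⟨hpos, him⟩ := Complex.pos_iff.1 (Matrix.dotProduct_star_self_pos_iff.2 hw0)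
  rw [hw, dotProduct_smul, smul_eq_mul, Complex.mul_re, ← him, mul_zero,
    sub_zero] at hneg
  exact neg_of_mul_neg_left hneg hpos.le

lemma isStable_of_conj {L C : Matrix ι ι ℝ} (hL : IsUnit L) (h : IsStable (L⁻¹ * C * L)) :
    IsStable C := by
  obtain ⟨u, rfl⟩ := hL
  let U : (Matrix ι ι ℂ)ˣ := Units.map (algebraMap ℝ ℂ).mapMatrix.toMonoidHom u
  have hconj : ((u : Matrix ι ι ℝ)⁻¹ * C * u).map (algebraMap ℝ ℂ) =
      (↑U⁻¹ : Matrix ι ι ℂ) * C.map (algebraMap ℝ ℂ) * U := by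
    rw [← Matrix.coe_units_inv, Matrix.map_mul, Matrix.map_mul]
    rfl
  rw [IsStable, hconj, spectrum.units_conjugate'] at h
  exact h

end Stability

lemma pow_mul_sq_le_one_of_log_le {ρ c : ℝ} {m : ℕ} (hm : m ≠ 0) (hρ₀ : 0 ≤ ρ) (hρ₁ : ρ < 1)
    (hc : 0 ≤ c) (h : 2 * Real.log c / (-Real.log ρ) ≤ m) : ρ ^ m * c ^ 2 ≤ 1 := by
  rcases hρ₀.eq_or_lt with rfl | hρ
  · simp [hm]
  rcases hc.eq_or_lt with rfl | hc
  · simp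
  have hpos : 0 < ρ ^ m * c ^ 2 := by positivity
  rw [div_le_iff₀ (neg_pos.2 (Real.log_neg hρ hρ₁))] at h
  rw [← Real.log_nonpos_iff hpos.le, Real.log_mul (by positivity) (by positivity), Real.log_pow,
    Real.log_pow, Nat.cast_ofNat]
  linarith

section NewtonKleinman

variable {ι : Type*} [Fintype ι] [DecidableEq ι] {A L Q X : Matrix ι ι ℝ}

lemma StrictlyDissipative.conj_closedLoop (hL : IsUnit L)
    (hA : StrictlyDissipative (L⁻¹ * A * L)) (hX : X.PosSemidef) :
    StrictlyDissipative (L⁻¹ * closedLoop A (L * Lᵀ) X * L) := by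
  have hsub : L⁻¹ * closedLoop A (L * Lᵀ) X * L = L⁻¹ * A * L - Lᵀ * X * L := by
    rw [closedLoop, Matrix.mul_sub, Matrix.sub_mul, Matrix.mul_assoc L,
      Matrix.nonsing_inv_mul_cancel_left _ _ (L.isUnit_iff_isUnit_det.1 hL)]
  intro v hv
  have hXv : 0 ≤ v ⬝ᵥ (Lᵀ * X * L) *ᵥ v := by
    simpa using (hX.conjTranspose_mul_mul_same L).dotProduct_mulVec_nonneg v
  rw [hsub, Matrix.sub_mulVec, dotProduct_sub]
  exact (sub_le_self _ hXv).trans_lt (hA v hv)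

lemma IsInnerSolve.frobNorm_residual_le_lambdaMin [Nonempty ι] (hL : IsUnit L) (hQ : Q.PosDef)
    (hA : StrictlyDissipative (L⁻¹ * A * L)) (hX : X.PosSemidef) {Y : Matrix ι ι ℝ} {m : ℕ}
    (hm₀ : m ≠ 0) (hm : iterBound A (L * Lᵀ) Q L X ≤ m)
    (hY : IsInnerSolve A (L * Lᵀ) Q X m Y) :
    frobNorm (-(X * (L * Lᵀ) * X + Q) -
      ((closedLoop A (L * Lᵀ) X)ᵀ * Y + Y * closedLoop A (L * Lᵀ) X)) ≤ lambdaMin Q := by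
  have hK := hA.conj_closedLoop hL hX
  have hS := StrictlyDissipative.scaledLyapMatrix hL hK
  have hq := lambdaMin_pos hQ
  rw [IsInnerSolve, ← Matrix.vec_neg] at hY
  have hres := frobNorm_residual_sq_le hL hK hY
  rw [frobNorm_neg] at hres
  set B := X * (L * Lᵀ) * X + Q
  set g := cond2 (L * Lᵀ) * frobNorm B
  set ρ := elmanFactor (scaledLyapMatrix L (closedLoop A (L * Lᵀ) X))
  have hg : 0 ≤ g :=
    mul_nonneg (mul_nonneg (specNorm_nonneg _) (specNorm_nonneg _)) (frobNorm_nonneg _)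
  have hρ := hS.elmanFactor_nonneg
  have hpow : ρ ^ m * ((1 + √2) * (g / lambdaMin Q)) ^ 2 ≤ 1 :=
    pow_mul_sq_le_one_of_log_le hm₀ hρ hS.elmanFactor_lt_one (by positivity) hm
  have hslack : g / lambdaMin Q ≤ (1 + √2) * (g / lambdaMin Q) :=
    le_mul_of_one_le_left (by positivity) (le_add_of_nonneg_right (Real.sqrt_nonneg 2))
  refine le_of_sq_le_sq (hres.trans ?_) hq.le
  calc ρ ^ m * g ^ 2 = ρ ^ m * (g / lambdaMin Q) ^ 2 * lambdaMin Q ^ 2 := by field_simp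
    _ ≤ ρ ^ m * ((1 + √2) * (g / lambdaMin Q)) ^ 2 * lambdaMin Q ^ 2 := by gcongr
    _ ≤ lambdaMin Q ^ 2 := mul_le_of_le_one_left (sq_nonneg _) hpow

lemma IsInnerSolve.posSemidef [Nonempty ι] (hL : IsUnit L) (hQ : Q.PosDef)
    (hA : StrictlyDissipative (L⁻¹ * A * L)) (hX : X.PosSemidef) {Y : Matrix ι ι ℝ} {m : ℕ}
    (hm : iterBound A (L * Lᵀ) Q L X ≤ m) (hY : IsInnerSolve A (L * Lᵀ) Q X m Y) :
    Y.PosSemidef := by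
  rcases eq_or_ne m 0 with rfl | hm₀
  · obtain rfl : Y = 0 := by simpa [krylov] using hY.mem
    exact Matrix.PosSemidef.zero
  have hres := hY.frobNorm_residual_le_lambdaMin hL hQ hA hX hm₀ hm
  rw [IsInnerSolve, ← Matrix.vec_neg] at hY
  set C := closedLoop A (L * Lᵀ) X
  have hXFX : (X * (L * Lᵀ) * X).PosSemidef := by
    simpa [(Matrix.isHermitian_iff_isSymm.1 hX.isHermitian).eq] using
      (Matrix.posSemidef_self_mul_conjTranspose L).conjTranspose_mul_mul_same X
  have hB : (-(X * (L * Lᵀ) * X + Q)).IsHermitian := (hXFX.isHermitian.add hQ.isHermitian).neg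
  have hYH : Y.IsHermitian := Matrix.isHermitian_iff_isSymm.2
    (isSymm_of_vec_mem_krylov_lyapMatrix (Matrix.isHermitian_iff_isSymm.1 hB) hY.mem)
  refine posSemidef_of_lyapunov hL (hA.conj_closedLoop hL hX) hYH ?_
  set R := -(X * (L * Lᵀ) * X + Q) - (Cᵀ * Y + Y * C) with hR
  have hRH : R.IsHermitian := by
    refine hB.sub ?_
    rw [Matrix.isHermitian_iff_isSymm] at hYH ⊢
    simp [Matrix.IsSymm, hYH.eq, add_comm]
  have hrhs : -(Cᵀ * Y + Y * C) = X * (L * Lᵀ) * X + (Q + R) := by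
    rw [hR]
    abel
  rw [hrhs]
  exact hXFX.add (posSemidef_add_of_frobNorm_le_lambdaMin hQ.isHermitian hRH hres)

end NewtonKleinman

lemma IsRun.lam_mem_Icc {ι : Type*} [Fintype ι] [DecidableEq ι] {A F Q X₀ : Matrix ι ι ℝ}
    {lineSearch : Bool} {α : ℝ} {N : ℕ} {it : ℕ → ℕ} {X Xhat : ℕ → Matrix ι ι ℝ} {lam : ℕ → ℝ}
    (h : IsRun A F Q X₀ lineSearch α N it X Xhat lam) {k : ℕ} (hk : k < N) :
    lam k ∈ Set.Icc 0 1 := by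
  cases hls : lineSearch with
  | false => simp [h.step_full hls k hk]
  | true => exact ⟨(h.step_search hls k hk).1.le, (h.step_search hls k hk).2.1.le⟩

end Tink

end

theorem theorem3p1_general {ι : Type*} [Fintype ι] [DecidableEq ι] [Nonempty ι]
    {A F Q L : Matrix ι ι ℝ} (hF : F.PosDef) (hL : L * Lᵀ = F)
    (hW : Tink.numericalRange ((L⁻¹ * A * L).map (algebraMap ℝ ℂ)) ⊆ {z : ℂ | z.re < 0})
    (hQ : Q.PosDef) {N : ℕ} {it : ℕ → ℕ} {X Xhat : ℕ → Matrix ι ι ℝ} {lam : ℕ → ℝ}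
    (hX₀ : (X 0).PosSemidef)
    (inner : ∀ k < N, Tink.IsInnerSolve A F Q (X k) (it k) (Xhat (k + 1)))
    (hlam : ∀ k < N, lam k ∈ Set.Icc 0 1)
    (update : ∀ k < N, X (k + 1) = (1 - lam k) • X k + lam k • Xhat (k + 1))
    (hit : ∀ k < N, Tink.iterBound A F Q L (X k) ≤ (it k : ℝ)) :
    ∀ k ≤ N,
      (IsUnit (Tink.lyapMatrix (Tink.closedLoop A F (X k))) ∧
        ∀ m : ℕ, ∃! Y : Matrix ι ι ℝ, Tink.IsInnerSolve A F Q (X k) m Y) ∧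
      (X k).IsSymm ∧ (X k).PosSemidef ∧
      Tink.IsStable (Tink.closedLoop A F (X k)) := by
  subst hL
  have hLu : IsUnit L := by
    simpa [Matrix.isUnit_iff_isUnit_det] using hF.isUnit
  have hA := Tink.strictlyDissipative_of_numericalRange hW
  have hpsd : ∀ k ≤ N, (X k).PosSemidef := by
    intro k
    induction k with
    | zero => exact fun _ => hX₀
    | succ k ih =>
      intro hk
      have hX := ih (k.le_succ.trans hk)
      have hXhat := (inner k hk).posSemidef hLu hQ hA hX (hit k hk)
      rw [update k hk]
      exact (hX.smul (sub_nonneg.2 (hlam k hk).2)).add (hXhat.smul (hlam k hk).1)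
  intro k hk
  have hK := hA.conj_closedLoop hLu (hpsd k hk)
  have hU := Tink.isUnit_lyapMatrix hLu hK
  exact ⟨⟨hU, Tink.existsUnique_isInnerSolve hU⟩,
    Matrix.isHermitian_iff_isSymm.1 (hpsd k hk).isHermitian, hpsd k hk,
    Tink.isStable_of_conj hLu hK.isStable⟩

theorem theorem3p1 (n : ℕ) (hn : 0 < n)
    (A F Q L X₀ : Matrix (Fin n) (Fin n) ℝ)
    (hF : F.PosDef) (hL : Tink.IsCholeskyFactor L F)
    (hW : Tink.numericalRange ((L⁻¹ * A * L).map (algebraMap ℝ ℂ)) ⊆ {z : ℂ | z.re < 0})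
    (hX₀ : X₀.PosSemidef) (hX₀_stable : Tink.IsStable (Tink.closedLoop A F X₀))
    (hQ : Q.PosDef)
    (lineSearch : Bool) (α : ℝ) (hα : 0 < α)
    (N : ℕ) (it : ℕ → ℕ) (X Xhat : ℕ → Matrix (Fin n) (Fin n) ℝ) (lam : ℕ → ℝ)
    (hrun : Tink.IsRun A F Q X₀ lineSearch α N it X Xhat lam)
    (hit : ∀ k < N, Tink.iterBound A F Q L (X k) ≤ (it k : ℝ)) :
    ∀ k ≤ N,
      -- the next inner problem is nonsingular and its GMRES iterates exist and are unique
      (IsUnit (Tink.lyapMatrix (Tink.closedLoop A F (X k))) ∧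
        ∀ m : ℕ, ∃! Y : Matrix (Fin n) (Fin n) ℝ, Tink.IsInnerSolve A F Q (X k) m Y) ∧
      (X k).IsSymm ∧ (X k).PosSemidef ∧
      Tink.IsStable (Tink.closedLoop A F (X k)) := by
  have : Nonempty (Fin n) := ⟨⟨0, hn⟩⟩
  exact theorem3p1_general hF hL.mul_transpose hW hQ (hrun.start ▸ hX₀) hrun.inner
    (fun _ => hrun.lam_mem_Icc) hrun.update hit
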